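/- Let $\lambda_1,\dots,\lambda_n$ be the adjacency eigenvalues of a graph $G$ on $n$ vertices and let $S_k(G)=\sum_{i=1}^n\lambda_i^k$ for $0\le k\le n-1$. For graphs $G,H$ on $n$ vertices write $G=_sH$ if $S_i(G)=S_i(H)$ for $0\le i\le n-1$, write $G\prec_sH$ if for some $1\le k\le n-1$ one has $S_i(G)=S_i(H)$ for $0\le i\le k-1$ and $S_k(G)<S_k(H)$, and write $G\preceq_sH$ if $G\prec_sH$ or $G=_sH$. For $p<q$ let $\mathscr T^{p,q}$ be the set of trees (up to isomorphism) whose vertex set is the disjoint union of two sets of sizes $p$ and $q$ such that every edge joins the two sets. Let $B^{k,l}_{p,q}$ be the tree with $p$ white and $q$ black vertices in which one white vertex is adjacent to all $q$ black vertices and the other $p-1$ white vertices are leaves, of which $k$ are attached to one black vertex, one is attached to each of $l$ further black vertices, and the remaining $p-1-k-l$ are attached to yet another black vertex. Let $D^{k,l}_{p,q}$ be the tree with $p$ white and $q$ black vertices obtained from $B^{k,l}_{q,p}$ by exchanging the two colours. **Theorem.** Let $p,q$ be integers with $4\le p<q$. (i) If $p>\frac{q+4}{2}$, then $B^{2,0}_{p,q}\in\mathscr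 T^{p,q}\setminus\{B^{0,0}_{p,q},B^{0,1}_{p,q},D^{0,1}_{p,q}\}$, and every $T$ in this set satisfies $T\preceq_s B^{2,0}_{p,q}$, with $T=_sB^{2,0}_{p,q}$ if and only if $T\cong B^{2,0}_{p,q}$. (ii) If $p=\frac{q+4}{2}$, then $D^{0,1}_{p,q}\in\mathscr T^{p,q}\setminus\{B^{0,0}_{p,q},B^{0,1}_{p,q},B^{2,0}_{p,q}\}$, and every $T$ in this set satisfies $T\preceq_s D^{0,1}_{p,q}$, with $T=_sD^{0,1}_{p,q}$ if and only if $T\cong D^{0,1}_{p,q}$. (iii) If $p<\frac{q+4}{2}$, then $B^{0,2}_{p,q}\in\mathscr T^{p,q}\setminus\{B^{0,0}_{p,q},B^{0,1}_{p,q},B^{2,0}_{p,q}\}$, and every $T$ in this set satisfies $T\preceq_s B^{0,2}_{p,q}$, with $T=_sB^{0,2}_{p,q}$ if and only if $T\cong B^{0,2}_{p,q}$. -/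

import Mathlib

/-- The `k`-th spectral moment `S_k(G) = ∑ λ_i ^ k`, the sum running over the eigenvalues
(with multiplicity) of the adjacency matrix of `G`. -/
noncomputable def spectralMoment {V : Type*} [Fintype V] (G : SimpleGraph V) (k : ℕ) : ℝ :=
  open Classical in ∑ i, (G.isHermitian_adjMatrix ℝ).eigenvalues i ^ k

/-- `G =_s H`: all spectral moments `S_0, …, S_{n-1}` agree (`n` is the order of the graphs). -/
def SEq {V W : Type*} [Fintype V] [Fintype W] (G : SimpleGraph V) (H : SimpleGraph W) : Prop :=
  Fintype.card V = Fintype.card W ∧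
    ∀ i < Fintype.card V, spectralMoment G i = spectralMoment H i

/-- `G ≺_s H`: for some `1 ≤ k ≤ n - 1`, the moments `S_0, …, S_{k-1}` agree and
`S_k(G) < S_k(H)` (`n` is the order of the graphs). -/
def SLt {V W : Type*} [Fintype V] [Fintype W] (G : SimpleGraph V) (H : SimpleGraph W) : Prop :=
  Fintype.card V = Fintype.card W ∧
    ∃ k, 1 ≤ k ∧ k < Fintype.card V ∧
      (∀ i < k, spectralMoment G i = spectralMoment H i) ∧
      spectralMoment G k < spectralMoment H k

/-- `G ⪯_s H`. -/
def SLe {V W : Type*} [Fintype V] [Fintype W] (G : SimpleGraph V) (H : SimpleGraph W) : Prop :=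
  SLt G H ∨ SEq G H

/-- `T` is a tree with a `(p, q)`-bipartition. -/
def IsBipartitionTree {V : Type*} (p q : ℕ) (T : SimpleGraph V) : Prop :=
  T.IsTree ∧ ∃ A : Set V, T.IsBipartiteWith A Aᶜ ∧ A.ncard = p ∧ Aᶜ.ncard = q

/-- The number of the black vertex to which the white vertex number `i ≥ 1` of `treeB` is attached:
black vertex `1` gets `k` white leaves, black vertices `2, …, l + 1` get one white leaf each,
and black vertex `0` gets all the remaining white leaves. -/
def hostB (k l i : ℕ) : ℕ :=
  if i ≤ k then 1 else if i ≤ k + l then i - k + 1 else 0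

/-- Adjacency of white vertex `i` and black vertex `j` in `treeB`: white vertex `0` is joined to all
black vertices, every other white vertex is a leaf. -/
def adjB (k l i j : ℕ) : Prop := i = 0 ∨ j = hostB k l i

/-- The tree `B_{p,q}^{k,l}` on `p` white vertices (`Sum.inl`) and `q` black vertices (`Sum.inr`):
a white vertex joined to all `q` black vertices, of which one carries `k` white leaves,
`l` others carry one white leaf each, and one more carries the remaining `p - 1 - k - l`
white leaves (a tree as soon as `q ≥ l + 2`; meant for `k + l ≤ p - 1`). -/
def treeB (p q k l : ℕ) : SimpleGraph (Fin p ⊕ Fin q) where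
  Adj x y := match x, y with
    | .inl i, .inr j => adjB k l i j
    | .inr j, .inl i => adjB k l i j
    | _, _ => False
  symm := ⟨fun x y h => by cases x <;> cases y <;> exact h⟩
  loopless := ⟨fun x h => by cases x <;> exact h⟩

/-- The tree `D_{p,q}^{k,l}` on `p` white vertices (`Sum.inl`) and `q` black vertices (`Sum.inr`):
as `treeB`, with the roles of the two colours exchanged (a black vertex is joined to all `p` white
vertices, which carry `k`, `1, …, 1` (`l` times) and `q - 1 - k - l` black leaves). -/
def treeD (p q k l : ℕ) : SimpleGraph (Fin p ⊕ Fin q) :=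
  (treeB q p k l).comap Sum.swap

/-- `T` belongs, up to isomorphism, to the set of trees with a `(p, q)`-bipartition from which the
graphs in `R` have been removed. -/
def IsRemainingTree {V : Type*} (p q : ℕ) (R : Set (SimpleGraph (Fin p ⊕ Fin q)))
    (T : SimpleGraph V) : Prop :=
  IsBipartitionTree p q T ∧ ∀ G ∈ R, IsEmpty (T ≃g G)

/-! Odd moments of a bipartite graph vanish, and the moments of order below 4 of a tree depend only
on its order. So the comparison is decided by S_4 and, when that ties, by S_6. A tree has no
4-cycle, which makes S_4 an increasing affine function of E = Σ (d - 1)², the sum running over all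
vertex degrees d (`spectralMoment_tree_four`).

Put P = p - 1 and Q = q - 1. The numbers d - 1 sum to Q over the white vertices and to P over the
black ones. If some white vertex is adjacent to all black ones, it uses up all of Q. The other white
vertices are then leaves, the tree is determined by how these P leaves are distributed over the
black vertices, and E = Q² + Σ load². By `hasShape_or_sum_sq_le` only the load patterns (P),
(P-1,1), (P-2,2), (P-2,1,1) reach Q² + (P-2)² + 2, except for a tie at P = 6 that S_6 breaks. If no
white vertex is full, the tree is D^{0,1}, or its E is below those of both D^{0,1} and B^{2,0}
(`classify_of_rowDeg_ne`).

Five trees remain to be compared. Here E(D^{0,1}) - E(B^{2,0}) = 2(2p - q - 4), which gives the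
trichotomy, and E(D^{0,1}) - E(B^{0,2}) = 2(2p - q - 3). In both cases of equality D^{0,1} has the
smaller S_6, by the explicit formula `spectralMoment_hostRel_six`. -/

open Finset Matrix

/-! ### Spectral moments as traces -/

/-- Spectral moments are traces of powers of the adjacency matrix. -/
theorem spectralMoment_eq_trace {V : Type*} [Fintype V] [DecidableEq V] (G : SimpleGraph V)
    [DecidableRel G.Adj] (k : ℕ) :
    spectralMoment G k = ((G.adjMatrix ℝ) ^ k).trace := by
  have hA := G.isHermitian_adjMatrix ℝ
  have h : ((G.adjMatrix ℝ) ^ k).trace = ∑ i, hA.eigenvalues i ^ k := by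
    conv_lhs => rw [hA.spectral_theorem, ← map_pow, Unitary.conjStarAlgAut_apply,
      trace_mul_comm, ← mul_assoc]
    simp [diagonal_pow, trace_diagonal]
  rw [h, spectralMoment]
  convert rfl

theorem spectralMoment_congr {V W : Type*} [Fintype V] [Fintype W] {G : SimpleGraph V}
    {H : SimpleGraph W} (e : G ≃g H) (k : ℕ) : spectralMoment G k = spectralMoment H k := by
  classical
  rw [spectralMoment_eq_trace, spectralMoment_eq_trace, ← SimpleGraph.Iso.reindex_adjMatrix ℝ e]
  have h : (reindex e.toEquiv e.toEquiv (G.adjMatrix ℝ)) ^ k =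
      reindex e.toEquiv e.toEquiv ((G.adjMatrix ℝ) ^ k) :=
    (map_pow (reindexAlgEquiv ℝ ℝ e.toEquiv) (G.adjMatrix ℝ) k).symm
  change _ = (reindex e.toEquiv e.toEquiv (G.adjMatrix ℝ) ^ k).trace
  rw [h]
  simp [trace, Equiv.sum_comp e.toEquiv.symm (fun i => (G.adjMatrix ℝ ^ k) i i)]

theorem spectralMoment_zero {V : Type*} [Fintype V] (G : SimpleGraph V) :
    spectralMoment G 0 = Fintype.card V := by
  simp [spectralMoment]

/-! ### Bipartite graphs of relations and their moments of order 2 and 4 -/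

/-- The bipartite graph of a relation. -/
def bip {α β : Type*} (R : α → β → Prop) : SimpleGraph (α ⊕ β) where
  Adj x y := match x, y with
    | .inl i, .inr j => R i j
    | .inr j, .inl i => R i j
    | _, _ => False
  symm := ⟨fun x y h => by cases x <;> cases y <;> exact h⟩
  loopless := ⟨fun x h => by cases x <;> exact h⟩

section
variable {α β : Type*} (R : α → β → Prop)

@[simp] theorem bip_adj_inl_inr (i : α) (j : β) : (bip R).Adj (.inl i) (.inr j) ↔ R i j := Iff.rfl
@[simp] theorem bip_adj_inr_inl (i : α) (j : β) : (bip R).Adj (.inr j) (.inl i) ↔ R i j := Iff.rfl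
@[simp] theorem bip_adj_inl_inl (i j : α) : ¬ (bip R).Adj (.inl i) (.inl j) := id
@[simp] theorem bip_adj_inr_inr (i j : β) : ¬ (bip R).Adj (.inr i) (.inr j) := id

open Classical in
/-- The number of elements related to `i`. -/
noncomputable def rowDeg [Fintype β] (i : α) : ℕ := #{j | R i j}

/-- The number of elements to which `j` is related. -/
noncomputable def colDeg [Fintype α] (j : β) : ℕ := rowDeg (flip R) j

open Classical in
/-- The biadjacency matrix of a relation. -/
noncomputable def biadj : Matrix α β ℝ := Matrix.of fun i j => if R i j then 1 else 0

theorem rowDeg_eq_sum [Fintype β] (i : α) : (rowDeg R i : ℝ) = ∑ j, biadj R i j := by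
  simp [rowDeg, biadj]

theorem colDeg_eq_sum [Fintype α] (j : β) : (colDeg R j : ℝ) = ∑ i, biadj R i j := by
  simp only [colDeg, rowDeg, biadj, flip, of_apply, sum_boole]
  congr!


theorem sum_colDeg [Fintype α] [Fintype β] : ∑ j, colDeg R j = ∑ i, rowDeg R i := by
  have h : (∑ j, (colDeg R j : ℝ)) = ∑ i, (rowDeg R i : ℝ) := by
    simp_rw [rowDeg_eq_sum, colDeg_eq_sum]
    exact sum_comm
  exact_mod_cast h

open Classical in
theorem adjMatrix_bip : (bip R).adjMatrix ℝ = fromBlocks 0 (biadj R) (biadj R)ᵀ 0 := by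
  ext (i | i) (j | j) <;> simp [biadj, SimpleGraph.adjMatrix_apply]

theorem gram_diag [Fintype β] (i : α) : (biadj R * (biadj R)ᵀ) i i = rowDeg R i := by
  rw [rowDeg_eq_sum]
  simp only [mul_apply, biadj, of_apply, transpose_apply, mul_ite, mul_one, mul_zero]
  exact sum_congr rfl fun j _ => by split_ifs <;> rfl

/-- Off the diagonal the Gram matrix counts common neighbours; the hypothesis forbids 4-cycles, so
each such entry is 0 or 1. -/
theorem gram_sq_of_ne [Fintype β]
    (h : ∀ i i' j j', i ≠ i' → R i j → R i' j → R i j' → R i' j' → j = j') {i i' : α}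
    (hi : i ≠ i') :
    (biadj R * (biadj R)ᵀ) i i' ^ 2 = (biadj R * (biadj R)ᵀ) i i' := by
  classical
  by_cases hj : ∃ j, R i j ∧ R i' j
  · obtain ⟨j, h1, h2⟩ := hj
    have : (biadj R * (biadj R)ᵀ) i i' = 1 := by
      rw [mul_apply, sum_eq_single j]
      · simp [biadj, h1, h2]
      · intro j' _ hj'
        simp only [biadj, of_apply, transpose_apply, mul_ite, mul_one, mul_zero]
        by_contra hc
        by_cases h3 : R i j' <;> by_cases h4 : R i' j' <;> simp [h3, h4] at hc
        exact hj' (h i i' j' j hi h3 h4 h1 h2)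
      · simp
    rw [this]; norm_num
  · push Not at hj
    have : (biadj R * (biadj R)ᵀ) i i' = 0 := by
      rw [mul_apply]
      refine sum_eq_zero fun j _ => ?_
      by_cases h3 : R i j
      · simp [biadj, hj j h3]
      · simp [biadj, h3]
    rw [this]; norm_num

variable [Fintype α] [Fintype β]

open Classical in
theorem adjMatrix_bip_pow_two_mul (k : ℕ) : (bip R).adjMatrix ℝ ^ (2 * k) =
    fromBlocks ((biadj R * (biadj R)ᵀ) ^ k) 0 0 (((biadj R)ᵀ * biadj R) ^ k) := by
  rw [pow_mul, adjMatrix_bip, pow_two, fromBlocks_multiply]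
  simp [fromBlocks_diagonal_pow]

theorem spectralMoment_bip_odd (k : ℕ) : spectralMoment (bip R) (2 * k + 1) = 0 := by
  classical
  rw [spectralMoment_eq_trace, pow_succ, adjMatrix_bip_pow_two_mul, adjMatrix_bip,
    fromBlocks_multiply]
  simp [trace]

open Classical in
theorem spectralMoment_bip_even (k : ℕ) : spectralMoment (bip R) (2 * k) =
    ((biadj R * (biadj R)ᵀ) ^ k).trace + (((biadj R)ᵀ * biadj R) ^ k).trace := by
  rw [spectralMoment_eq_trace, adjMatrix_bip_pow_two_mul]
  simp [trace]

theorem spectralMoment_bip_two : spectralMoment (bip R) 2 = 2 * (∑ i, rowDeg R i : ℕ) := by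
  classical
  have h := spectralMoment_bip_even R 1
  rw [pow_one, pow_one, trace_mul_comm (biadj R)ᵀ, ← two_mul] at h
  rw [show 2 = 2 * 1 from rfl, h]
  push_cast
  simp_rw [rowDeg_eq_sum]
  simp [trace, mul_apply, biadj, ← ite_and]

/-- Both Gram matrices have the same trace of the square, whence the factor 2. For the white one
this trace is the sum of the squared entries. Off the diagonal squaring changes nothing, and the sum
of all entries counts pairs of white vertices over their common neighbours, giving Σ colDeg². -/
theorem spectralMoment_bip_four
    (h : ∀ i i' j j', i ≠ i' → R i j → R i' j → R i j' → R i' j' → j = j') :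
    spectralMoment (bip R) 4 =
      2 * ((∑ i, rowDeg R i ^ 2 : ℕ) + (∑ j, colDeg R j ^ 2 : ℕ) - (∑ i, rowDeg R i : ℕ)) := by
  classical
  have h4 := spectralMoment_bip_even R 2
  have e1 : (((biadj R)ᵀ * biadj R) ^ 2).trace = ((biadj R * (biadj R)ᵀ) ^ 2).trace := by
    rw [pow_two, pow_two, Matrix.mul_assoc, trace_mul_comm]
    simp only [Matrix.mul_assoc]
  rw [e1, ← two_mul] at h4
  rw [show 4 = 2 * 2 from rfl, h4]
  congr 1
  set M := biadj R * (biadj R)ᵀ with hM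
  have hsymm : ∀ i i', M i' i = M i i' := fun i i' => by
    simp [hM, mul_apply, mul_comm]
  have e2 : (M ^ 2).trace = ∑ i, ∑ i', M i i' ^ 2 := by
    simp [trace, pow_two, mul_apply, hsymm]
  -- Only the diagonal entry, equal to the degree, differs from its square.
  have e3 : ∀ i, ∑ i', M i i' ^ 2 = ∑ i', M i i' + ((rowDeg R i : ℝ) ^ 2 - rowDeg R i) := by
    intro i
    rw [← sub_eq_iff_eq_add', ← sum_sub_distrib, sum_eq_single i]
    · rw [hM, gram_diag]
    · intro i' _ hi
      rw [hM, gram_sq_of_ne R h (Ne.symm hi), sub_self]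
    · simp
  have e4 : ∑ i, ∑ i', M i i' = ∑ j, (colDeg R j : ℝ) ^ 2 := by
    simp_rw [colDeg_eq_sum, pow_two, sum_mul_sum, hM, mul_apply, transpose_apply]
    rw [sum_comm' (t' := univ) (s' := fun _ => univ) (by simp)]
    simp_rw [sum_comm (s := (univ : Finset α)) (t := (univ : Finset β))]
    refine sum_congr rfl fun j _ => ?_
    rw [sum_comm]
  rw [e2, sum_congr rfl fun i _ => e3 i, sum_add_distrib, e4, sum_sub_distrib]
  push_cast
  ring

end

/-! ### Bipartitions, trees and degree sums -/

section
variable {α β : Type*} (R : α → β → Prop)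

/-- The bipartite graph of a relation does not depend on the labelling. -/
def bipIso {α' β' : Type*} {R : α → β → Prop} {R' : α' → β' → Prop} (e : α ≃ α') (f : β ≃ β')
    (h : ∀ i j, R i j ↔ R' (e i) (f j)) : bip R ≃g bip R' where
  toEquiv := Equiv.sumCongr e f
  map_rel_iff' := by
    rintro (i | i) (j | j) <;> simp [h]

/-- Exchanging the colour classes. -/
def bipFlip : bip R ≃g bip (flip R) where
  toEquiv := Equiv.sumComm α β
  map_rel_iff' := by
    rintro (i | i) (j | j) <;> simp [flip]

/-- A graph with a bipartition is the bipartite graph of a relation. -/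
theorem nonempty_iso_bip {V : Type*} {G : SimpleGraph V} {A : Set V}
    (h : G.IsBipartiteWith A Aᶜ) :
    Nonempty (G ≃g bip fun (a : A) (b : (Aᶜ : Set V)) => G.Adj a b) := by
  classical
  refine ⟨RelIso.symm ⟨Equiv.Set.sumCompl A, ?_⟩⟩
  rintro (⟨i, hi⟩ | ⟨i, hi⟩) (⟨j, hj⟩ | ⟨j, hj⟩)
  · simp only [Equiv.Set.sumCompl_apply_inl, bip_adj_inl_inl, iff_false]
    exact fun hadj => h.mem_of_mem_adj hi hadj hj
  · simp
  · simp [G.adj_comm]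
  · simp only [Equiv.Set.sumCompl_apply_inr, bip_adj_inr_inr, iff_false]
    exact fun hadj => hj (h.mem_of_mem_adj' hi hadj.symm)

theorem bip_isBipartiteWith :
    (bip R).IsBipartiteWith (Set.range Sum.inl) (Set.range Sum.inl)ᶜ where
  disjoint := disjoint_compl_right
  mem_of_adj := by rintro (i | i) (j | j) h <;> simp_all

theorem isBipartitionTree_bip {p q : ℕ} (R : α → β → Prop) (hα : Nat.card α = p)
    (hβ : Nat.card β = q) (h : (bip R).IsTree) : IsBipartitionTree p q (bip R) := by
  refine ⟨h, _, bip_isBipartiteWith R, ?_, ?_⟩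
  · rw [← hα]
    exact Set.ncard_range_of_injective Sum.inl_injective
  · rw [← hβ, Set.compl_range_inl]
    exact Set.ncard_range_of_injective Sum.inr_injective

theorem isTree_flip {R : α → β → Prop} (h : (bip R).IsTree) : (bip (flip R)).IsTree :=
  (bipFlip R).isTree_iff.1 h

/-- Two distinct common neighbours would give two different paths between `i` and `i'`. -/
theorem linear_of_isTree {R : α → β → Prop} (h : (bip R).IsTree) (i i' : α) (j j' : β) (hi : i ≠ i') (h1 : R i j)
    (h2 : R i' j) (h3 : R i j') (h4 : R i' j') : j = j' := by
  have w : ∀ k, R i k → R i' k → ∃ P : (bip R).Path (.inl i) (.inl i'),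
      P.1.support = [.inl i, .inr k, .inl i'] := fun k ha hb =>
    ⟨⟨.cons (v := .inr k) (by simpa) (.cons (v := .inl i') (by simpa) .nil), by simp [hi]⟩, rfl⟩
  obtain ⟨P, hP⟩ := w j h1 h2
  obtain ⟨P', hP'⟩ := w j' h3 h4
  rw [(h.isAcyclic.subsingleton_path _ _).elim P P', hP'] at hP
  simpa using hP.symm

variable [Fintype α] [Fintype β]

open Classical in
theorem degree_inl (i : α) : (bip R).degree (.inl i) = rowDeg R i := by
  rw [← SimpleGraph.card_neighborFinset_eq_degree, SimpleGraph.neighborFinset_eq_filter,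
    card_filter, Fintype.sum_sum_type]
  simp [rowDeg]

open Classical in
theorem degree_inr (j : β) : (bip R).degree (.inr j) = colDeg R j := by
  rw [← SimpleGraph.card_neighborFinset_eq_degree, SimpleGraph.neighborFinset_eq_filter,
    card_filter, Fintype.sum_sum_type]
  simp only [bip_adj_inr_inl, bip_adj_inr_inr, colDeg, rowDeg, flip, if_false, sum_const_zero,
    add_zero, sum_boole, Nat.cast_id]
  congr!

open Classical in
theorem card_edgeFinset_bip : #(bip R).edgeFinset = ∑ i, rowDeg R i := by
  have h := (bip R).sum_degrees_eq_twice_card_edges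
  rw [Fintype.sum_sum_type] at h
  simp only [degree_inl, degree_inr, sum_colDeg] at h
  omega

variable {R}

theorem sum_rowDeg (h : (bip R).IsTree) :
    ∑ i, rowDeg R i + 1 = Fintype.card α + Fintype.card β := by
  classical
  rw [← card_edgeFinset_bip, h.card_edgeFinset, Fintype.card_sum]

theorem rowDeg_pos [Nonempty β] (h : (bip R).IsTree) (i : α) : 0 < rowDeg R i := by
  classical
  have : Nontrivial (α ⊕ β) := ⟨.inl i, .inr (Classical.arbitrary β), by simp⟩
  rw [← degree_inl]
  exact h.connected.preconnected.degree_pos_of_nontrivial _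

theorem colDeg_pos [Nonempty α] (h : (bip R).IsTree) (j : β) : 0 < colDeg R j :=
  rowDeg_pos (isTree_flip h) j

/-- The sum of the squares of the numbers `d - 1` over all vertex degrees `d`. -/
noncomputable def excessSq (R : α → β → Prop) : ℕ :=
  ∑ i, (rowDeg R i - 1) ^ 2 + ∑ j, (colDeg R j - 1) ^ 2

theorem excessSq_flip (R : α → β → Prop) : excessSq (flip R) = excessSq R := by
  rw [excessSq, excessSq, add_comm]
  rfl

theorem sum_sq_eq {ι : Type*} [Fintype ι] (f : ι → ℕ) (hf : ∀ i, 0 < f i) :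
    (∑ i, f i ^ 2 : ℕ) + Fintype.card ι = ∑ i, (f i - 1) ^ 2 + 2 * ∑ i, f i := by
  rw [mul_sum, ← sum_add_distrib, Fintype.card_eq_sum_ones, ← sum_add_distrib]
  refine sum_congr rfl fun i _ => ?_
  obtain ⟨k, hk⟩ := Nat.exists_eq_add_of_lt (hf i)
  simp only [hk, zero_add, Nat.add_sub_cancel]
  ring

theorem sum_sub_one {ι : Type*} [Fintype ι] (f : ι → ℕ) (hf : ∀ i, 0 < f i) :
    ∑ i, (f i - 1) + Fintype.card ι = ∑ i, f i := by
  rw [Fintype.card_eq_sum_ones, ← sum_add_distrib]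
  exact sum_congr rfl fun i _ => Nat.sub_add_cancel (hf i)

/-- Expand Σ d² = Σ (d - 1)² + 2 Σ d - n over all vertices; the degrees in each colour class sum to
n - 1. -/
theorem spectralMoment_tree_four [Nonempty α] [Nonempty β] (h : (bip R).IsTree) :
    spectralMoment (bip R) 4 = 2 * (excessSq R + 2 * Fintype.card (α ⊕ β) - 3) := by
  rw [spectralMoment_bip_four R (linear_of_isTree h)]
  have e1 := sum_sq_eq (rowDeg R) (rowDeg_pos h)
  have e2 := sum_sq_eq (colDeg R) (colDeg_pos h)
  have e3 := sum_rowDeg h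
  rw [sum_colDeg] at e2
  rw [excessSq, Fintype.card_sum]
  have e1' := congrArg (Nat.cast (R := ℝ)) e1
  have e2' := congrArg (Nat.cast (R := ℝ)) e2
  have e3' := congrArg (Nat.cast (R := ℝ)) e3
  rw [Nat.cast_add, Nat.cast_add, Nat.cast_mul] at e1' e2'
  rw [Nat.cast_add, Nat.cast_add] at e3'
  rw [Nat.cast_add, Nat.cast_add]
  push_cast at *
  linarith

end

/-! ### Comparing two trees through S_4 and S_6 -/

section
variable {α β α' β' : Type*} [Fintype α] [Fintype β] [Fintype α'] [Fintype β']
  {R : α → β → Prop} {R' : α' → β' → Prop}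

theorem spectralMoment_eq_of_lt_four (h : (bip R).IsTree) (h' : (bip R').IsTree)
    (hc : Fintype.card (α ⊕ β) = Fintype.card (α' ⊕ β')) (i : ℕ) (hi : i < 4) :
    spectralMoment (bip R) i = spectralMoment (bip R') i := by
  have e := sum_rowDeg h
  have e' := sum_rowDeg h'
  simp only [Fintype.card_sum] at hc
  have e0 : ∑ i, rowDeg R i = ∑ i, rowDeg R' i := by omega
  interval_cases i
  · simp only [spectralMoment_zero, Fintype.card_sum, hc]
  · rw [spectralMoment_bip_odd R 0, spectralMoment_bip_odd R' 0]
  · rw [spectralMoment_bip_two, spectralMoment_bip_two, e0]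
  · rw [spectralMoment_bip_odd R 1, spectralMoment_bip_odd R' 1]

variable [Nonempty α] [Nonempty β] [Nonempty α'] [Nonempty β']

theorem sLt_of_excessSq_lt (h : (bip R).IsTree) (h' : (bip R').IsTree)
    (hc : Fintype.card (α ⊕ β) = Fintype.card (α' ⊕ β')) (hn : 4 < Fintype.card (α ⊕ β))
    (hlt : excessSq R < excessSq R') : SLt (bip R) (bip R') := by
  refine ⟨hc, 4, by norm_num, hn, spectralMoment_eq_of_lt_four h h' hc, ?_⟩
  rw [spectralMoment_tree_four h, spectralMoment_tree_four h', hc]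
  have : (excessSq R : ℝ) < excessSq R' := by exact_mod_cast hlt
  linarith

theorem sLt_of_excessSq_eq (h : (bip R).IsTree) (h' : (bip R').IsTree)
    (hc : Fintype.card (α ⊕ β) = Fintype.card (α' ⊕ β')) (hn : 6 < Fintype.card (α ⊕ β))
    (heq : excessSq R = excessSq R')
    (hlt : spectralMoment (bip R) 6 < spectralMoment (bip R') 6) : SLt (bip R) (bip R') := by
  refine ⟨hc, 6, by norm_num, hn, fun i hi => ?_, hlt⟩
  rcases lt_or_ge i 4 with h4 | h4
  · exact spectralMoment_eq_of_lt_four h h' hc i h4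
  · interval_cases i
    · rw [spectralMoment_tree_four h, spectralMoment_tree_four h', hc, heq]
    · rw [spectralMoment_bip_odd R 2, spectralMoment_bip_odd R' 2]

end

/-! ### Formal properties of the order -/

section
variable {U V W : Type*} [Fintype U] [Fintype V] [Fintype W]
  {F : SimpleGraph U} {G : SimpleGraph V} {H : SimpleGraph W}

theorem sEq_of_iso (e : F ≃g G) : SEq F G :=
  ⟨Fintype.card_congr e.toEquiv, fun i _ => spectralMoment_congr e i⟩

theorem SLt.congr_left (e : F ≃g G) (h : SLt G H) : SLt F H := by
  obtain ⟨hc, k, h1, h2, h3, h4⟩ := h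
  have := Fintype.card_congr e.toEquiv
  refine ⟨this.trans hc, k, h1, this ▸ h2, fun i hi => ?_, ?_⟩
  · rw [spectralMoment_congr e, h3 i hi]
  · rwa [spectralMoment_congr e]

theorem SLt.congr_right (e : G ≃g H) (h : SLt F G) : SLt F H := by
  obtain ⟨hc, k, h1, h2, h3, h4⟩ := h
  refine ⟨hc.trans (Fintype.card_congr e.toEquiv), k, h1, h2, fun i hi => ?_, ?_⟩
  · rw [← spectralMoment_congr e, h3 i hi]
  · rwa [← spectralMoment_congr e]

/-- The first difference between `F` and `H` occurs at the smaller of the two indices of first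
difference. -/
theorem SLt.trans (h : SLt F G) (h' : SLt G H) : SLt F H := by
  obtain ⟨hc, k, h1, h2, h3, h4⟩ := h
  obtain ⟨hc', k', h1', h2', h3', h4'⟩ := h'
  refine ⟨hc.trans hc', min k k', by omega, by omega, fun i hi => ?_, ?_⟩
  · rw [h3 i (by omega), h3' i (by omega)]
  · rcases lt_trichotomy k k' with hk | rfl | hk
    · rw [min_eq_left hk.le, ← h3' k hk]; exact h4
    · rw [min_self]; exact h4.trans h4'
    · rw [min_eq_right hk.le, h3 k' hk]; exact h4'

theorem SLt.not_sEq (h : SLt F G) : ¬ SEq F G := by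
  obtain ⟨_, k, _, h2, _, h4⟩ := h
  exact fun h' => h4.ne (h'.2 k h2)

theorem SLt.isEmpty_iso (h : SLt F G) : IsEmpty (F ≃g G) :=
  ⟨fun e => h.not_sEq (sEq_of_iso e)⟩

end

/-! ### Trees with a white vertex adjacent to all black vertices -/

section
variable {α β α' β' : Type*}

/-- The relation of a tree in which one white vertex (with `g i = none`) is joined to all black
vertices, every other white vertex `i` being a leaf attached to the black vertex `g i`. -/
def hostRel (g : α → Option β) (i : α) (j : β) : Prop := g i = none ∨ g i = some j

open Classical in
/-- The number of white leaves attached to the black vertex `j`. -/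
noncomputable def load [Fintype α] (g : α → Option β) (j : β) : ℕ := #{i | g i = some j}

/-- Such a tree is determined by its loads: matching loads make the fibres of `g` and `g'`
equinumerous, and bijections between the fibres assemble to one between the white vertices. -/
theorem nonempty_iso_hostRel [Fintype α] [Fintype α'] {g : α → Option β} {g' : α' → Option β'}
    {c : α} {c' : α'} (hc : ∀ i, g i = none ↔ i = c) (hc' : ∀ i, g' i = none ↔ i = c')
    (e : β ≃ β') (h : ∀ j, load g' (e j) = load g j) :
    Nonempty (bip (hostRel g) ≃g bip (hostRel g')) := by
  classical
  have key : ∀ o : Option β, Nonempty ({i // e.optionCongr (g i) = e.optionCongr o} ≃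
      {i // g' i = e.optionCongr o}) := by
    intro o
    refine ⟨Fintype.equivOfCardEq ?_⟩
    rw [Fintype.card_subtype, Fintype.card_subtype]
    simp only [EmbeddingLike.apply_eq_iff_eq]
    cases o with
    | none =>
      rw [Equiv.optionCongr_apply, Option.map_none]
      rw [card_eq_one.2 ⟨c, by ext; simp [hc]⟩, card_eq_one.2 ⟨c', by ext; simp [hc']⟩]
    | some j => 
      have := h j
      simp only [load] at this
      rw [Equiv.optionCongr_apply, Option.map_some]
      convert this.symm
  have key' : ∀ o : Option β', Nonempty ({i // e.optionCongr (g i) = o} ≃ {i // g' i = o}) := by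
    intro o
    simpa using key (e.optionCongr.symm o)
  let f : α ≃ α' := Equiv.ofFiberEquiv fun o => (key' o).some
  have hf : ∀ i, g' (f i) = (g i).map e := fun i =>
    Equiv.ofFiberEquiv_map (fun o => (key' o).some) i
  refine ⟨bipIso f e fun i j => ?_⟩
  rw [hostRel, hostRel, hf]
  cases g i <;> simp

theorem colDeg_hostRel [Fintype α] {g : α → Option β} {c : α} (hc : ∀ i, g i = none ↔ i = c) (j : β) :
    colDeg (hostRel g) j = load g j + 1 := by
  classical
  rw [load, ← card_insert_of_notMem (a := c) (by simp [(hc c).2 rfl])]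
  refine congrArg card ?_
  ext i
  simp [flip, hostRel, hc]

/-- The centre is a common neighbour of every pair of black vertices, while a leaf contributes only
to the diagonal entry of its host. The result is J + diag(load), with J the all-ones matrix. -/
theorem gram_hostRel [Fintype α] [DecidableEq β] {g : α → Option β} {c : α} (hc : ∀ i, g i = none ↔ i = c) :
    (biadj (hostRel g))ᵀ * biadj (hostRel g) =
      Matrix.of fun j k => 1 + if j = k then (load g j : ℝ) else 0 := by
  classical
  ext j k
  have h : ∀ i, (biadj (hostRel g))ᵀ j i * biadj (hostRel g) i k =
      (if i = c then 1 else 0) + if j = k then (if g i = some j then 1 else 0) else 0 := by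
    intro i
    by_cases hi : i = c
    · simp [biadj, hostRel, hi, (hc c).2 rfl]
    · have hi' : g i ≠ none := fun h => hi ((hc i).1 h)
      obtain ⟨m, hm⟩ := Option.ne_none_iff_exists'.1 hi'
      by_cases h1 : m = j <;> by_cases h2 : m = k
      · subst h1; subst h2; simp [biadj, hostRel, hi, hm]
      · subst h1; simp [biadj, hostRel, hi, hm, h2]
      · have : j ≠ k := fun h => h1 (h2.trans h.symm)
        simp [biadj, hostRel, hi, hm, h1, this]
      · simp [biadj, hostRel, hi, hm, h1]
  rw [mul_apply, sum_congr rfl fun i _ => h i, sum_add_distrib]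
  by_cases hjk : j = k
  · subst hjk
    simp [load]
    congr!
  · simp [hjk]

variable [Fintype β] {g : α → Option β} {c : α}

theorem rowDeg_hostRel_center (hc : g c = none) : rowDeg (hostRel g) c = Fintype.card β := by
  simp [rowDeg, hostRel, hc]

theorem rowDeg_hostRel_leaf {i : α} (hi : g i ≠ none) : rowDeg (hostRel g) i = 1 := by
  obtain ⟨j, hj⟩ := Option.ne_none_iff_exists'.1 hi
  have h : ∀ k, hostRel g i k ↔ k = j := fun k => by simp [hostRel, hj, eq_comm]
  exact card_eq_one.2 ⟨j, by ext; simp [h]⟩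

variable [Fintype α]

theorem sum_rowDeg_hostRel (hc : ∀ i, g i = none ↔ i = c) :
    ∑ i, rowDeg (hostRel g) i + 1 = Fintype.card α + Fintype.card β := by
  classical
  rw [← add_sum_erase _ _ (mem_univ c), rowDeg_hostRel_center ((hc c).2 rfl),
    sum_congr rfl (g := fun _ => 1) fun i hi => rowDeg_hostRel_leaf fun h =>
      (mem_erase.1 hi).1 ((hc i).1 h)]
  have : 0 < Fintype.card α := Fintype.card_pos_iff.2 ⟨c⟩
  simp
  omega

theorem sum_load (hc : ∀ i, g i = none ↔ i = c) : ∑ j, load g j + 1 = Fintype.card α := by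
  have h := sum_rowDeg_hostRel hc
  rw [← sum_colDeg] at h
  simp only [colDeg_hostRel hc, sum_add_distrib] at h
  simp at h
  omega

theorem isTree_hostRel (hc : ∀ i, g i = none ↔ i = c) : (bip (hostRel g)).IsTree := by
  classical
  rw [SimpleGraph.isTree_iff_connected_and_card]
  have h1 : ∀ j, (bip (hostRel g)).Reachable (.inr j) (.inl c) := fun j =>
    SimpleGraph.Adj.reachable (by simp [hostRel, hc])
  constructor
  · rw [SimpleGraph.connected_iff_exists_forall_reachable]
    refine ⟨.inl c, ?_⟩
    rintro (i | j)
    · by_cases hi : g i = none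
      · rw [(hc i).1 hi]
      · obtain ⟨j, hj⟩ := Option.ne_none_iff_exists'.1 hi
        exact (h1 j).symm.trans (SimpleGraph.Adj.reachable (by simp [hostRel, hj]))
    · exact (h1 j).symm
  · rw [Nat.card_eq_fintype_card, ← SimpleGraph.edgeFinset_card, card_edgeFinset_bip,
      sum_rowDeg_hostRel hc]
    simp

theorem excessSq_hostRel (hc : ∀ i, g i = none ↔ i = c) :
    excessSq (hostRel g) = (Fintype.card β - 1) ^ 2 + ∑ j, load g j ^ 2 := by
  classical
  rw [excessSq, sum_eq_single c, rowDeg_hostRel_center ((hc c).2 rfl)]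
  · simp [colDeg_hostRel hc]
  · intro i _ hi
    rw [rowDeg_hostRel_leaf (fun h => hi ((hc i).1 h))]
    rfl
  · simp

/-- This is the expansion of tr (J + D)³ with D diagonal, using J² = |β| J and the fact that tr (J
D^k) is the sum of the k-th powers of the diagonal of D. -/
theorem trace_cube_one_add_diagonal [DecidableEq β] (y : β → ℝ) :
    ((Matrix.of fun j k => 1 + if j = k then y j else 0) ^ 3).trace =
      (Fintype.card β : ℝ) ^ 3 + 3 * Fintype.card β * ∑ j, y j + 3 * ∑ j, y j ^ 2 +
        ∑ j, y j ^ 3 := by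
  set M : Matrix β β ℝ := Matrix.of fun j k => 1 + if j = k then y j else 0 with hM
  have h2 : ∀ j k, (M * M) j k =
      Fintype.card β + y j + y k + if j = k then y j ^ 2 else 0 := by
    intro j k
    simp only [hM, mul_apply, of_apply, mul_add, add_mul, sum_add_distrib]
    by_cases hjk : j = k
    · subst hjk
      simp
      ring
    · simp [hjk]
  have h3 : ∀ j, ∑ k, (M * M) j k * M k j = (Fintype.card β : ℝ) ^ 2 +
      2 * Fintype.card β * y j + ∑ k, y k + 3 * y j ^ 2 + y j ^ 3 := by
    intro j
    have : ∀ k, (M * M) j k * M k j = Fintype.card β + y j + y k +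
        if j = k then y j ^ 2 + (Fintype.card β + 2 * y j + y j ^ 2) * y j else 0 := by
      intro k
      rw [h2]
      by_cases hjk : j = k
      · subst hjk
        simp [hM]
        ring
      · simp [hM, hjk, Ne.symm hjk]
    simp only [this, sum_add_distrib]
    simp
    ring
  rw [pow_succ, pow_two, trace]
  simp only [diag_apply, mul_apply (M := M * M), h3, sum_add_distrib, ← mul_sum]
  simp
  ring

theorem spectralMoment_hostRel_six (hc : ∀ i, g i = none ↔ i = c) :
    spectralMoment (bip (hostRel g)) 6 =
      2 * ((Fintype.card β : ℝ) ^ 3 + 3 * Fintype.card β * (∑ j, load g j : ℕ) +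
        3 * (∑ j, load g j ^ 2 : ℕ) + (∑ j, load g j ^ 3 : ℕ)) := by
  classical
  have h := spectralMoment_bip_even (hostRel g) 3
  set N := biadj (hostRel g)
  have e : ((N * Nᵀ) ^ 3).trace = ((Nᵀ * N) ^ 3).trace := by
    rw [pow_succ, pow_succ (Nᵀ * N), pow_two, pow_two, ← Matrix.mul_assoc, trace_mul_comm]
    simp only [Matrix.mul_assoc]
  rw [show 6 = 2 * 3 from rfl, h, e, gram_hostRel hc, trace_cube_one_add_diagonal]
  push_cast
  ring

/-- A tree in which some white vertex is adjacent to all black ones comes from `hostRel`. -/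
theorem exists_eq_hostRel [Nonempty β] {R : α → β → Prop} (h : (bip R).IsTree)
    (hd : rowDeg R c = Fintype.card β) :
    ∃ g : α → Option β, (∀ i, g i = none ↔ i = c) ∧ R = hostRel g := by
  classical
  have hs := sum_rowDeg h
  have hpos := rowDeg_pos h
  have hR : ∀ j, R c j := by
    have := (card_eq_iff_eq_univ _).1 hd
    intro j
    have hj : j ∈ (univ.filter fun j => R c j) := by
      rw [this]; exact mem_univ j
    simpa using hj
  -- The white numbers d - 1 sum to |β| - 1, all of which is taken by `c`.
  have h1 : ∀ i, i ≠ c → rowDeg R i = 1 := by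
    have hsub := sum_sub_one (rowDeg R) hpos
    have hle : ∀ i, i ≠ c → (rowDeg R c - 1) + (rowDeg R i - 1) ≤ ∑ i, (rowDeg R i - 1) := by
      intro i hi
      rw [← sum_pair (f := fun i => rowDeg R i - 1) hi.symm]
      exact sum_le_sum_of_subset (subset_univ _)
    intro i hi
    have := hle i hi
    have := hpos i
    have := hpos c
    omega
  have h2 : ∀ i, ∃ o : Option β, (o = none ↔ i = c) ∧ ∀ j, R i j ↔ (o = none ∨ o = some j) := by
    intro i
    by_cases hi : i = c
    · exact ⟨none, by simp [hi], by simp [hi, hR]⟩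
    · obtain ⟨j, hj⟩ := card_eq_one.1 (h1 i hi)
      refine ⟨some j, by simp [hi], fun k => ?_⟩
      have : k ∈ (univ.filter fun j => R i j) ↔ k ∈ ({j} : Finset β) := by
        rw [← hj]
      simp only [mem_filter, mem_univ, true_and, mem_singleton] at this
      simp [this, eq_comm]
  choose g hg using h2
  exact ⟨g, fun i => (hg i).1, by ext i j; exact (hg i).2 j⟩

end

/-! ### Sums of squares of natural numbers with a given sum -/

section
variable {ι κ : Type*}

/-- `y` takes the values `s` and `t` at two places and vanishes elsewhere, with the exception of
a third place. -/
def HasShape (y : ι → ℕ) (s t : ℕ) : Prop :=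
  ∃ a b c, a ≠ b ∧ a ≠ c ∧ b ≠ c ∧ y b = s ∧ y c = t ∧ ∀ j, j ≠ a → j ≠ b → j ≠ c → y j = 0

theorem HasShape.exists_sum_pow [Fintype ι] {y : ι → ℕ} {s t : ℕ} (h : HasShape y s t) :
    ∃ a, y a + s + t = ∑ j, y j ∧
      ∀ k, ∑ j, y j ^ (k + 1) = y a ^ (k + 1) + s ^ (k + 1) + t ^ (k + 1) := by
  classical
  obtain ⟨a, b, c, hab, hac, hbc, rfl, rfl, h0⟩ := h
  have key : ∀ k, ∑ j, y j ^ (k + 1) = y a ^ (k + 1) + y b ^ (k + 1) + y c ^ (k + 1) := by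
    intro k
    rw [← sum_subset (subset_univ {a, b, c}), sum_insert (by simp [hab, hac]), sum_pair hbc,
      add_assoc]
    intro j _ hj
    simp only [mem_insert, mem_singleton, not_or] at hj
    rw [h0 j hj.1 hj.2.1 hj.2.2, zero_pow k.succ_ne_zero]
  refine ⟨a, ?_, key⟩
  simpa using (key 0).symm

theorem exists_equiv_three [Fintype ι] [Fintype κ] (hc : Fintype.card ι = Fintype.card κ)
    {a b c : ι} {a' b' c' : κ} (hab : a ≠ b) (hac : a ≠ c) (hbc : b ≠ c) (hab' : a' ≠ b')
    (hac' : a' ≠ c') (hbc' : b' ≠ c') : ∃ e : ι ≃ κ, e a = a' ∧ e b = b' ∧ e c = c' := by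
  classical
  let e := Fintype.equivOfCardEq hc
  -- Each swap corrects one image and, the points being distinct, leaves the images already
  -- corrected in place.
  let e1 := e.trans (Equiv.swap (e a) a')
  have h1 : e1 a = a' := by simp [e1]
  let e2 := e1.trans (Equiv.swap (e1 b) b')
  have h2 : e2 a = a' := by
    simp only [e2, Equiv.trans_apply, h1]
    exact Equiv.swap_apply_of_ne_of_ne (h1 ▸ e1.injective.ne hab) hab'
  have h2' : e2 b = b' := by simp [e2]
  refine ⟨e2.trans (Equiv.swap (e2 c) c'), ?_, ?_, by simp⟩
  · simp only [Equiv.trans_apply, h2]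
    exact Equiv.swap_apply_of_ne_of_ne (h2 ▸ e2.injective.ne hac) hac'
  · simp only [Equiv.trans_apply, h2']
    exact Equiv.swap_apply_of_ne_of_ne (h2' ▸ e2.injective.ne hbc) hbc'

/-- The value at the exceptional place is forced by the total, so matching the three distinguished
places suffices. -/
theorem HasShape.exists_equiv [Fintype ι] [Fintype κ] (hc : Fintype.card ι = Fintype.card κ)
    {y : ι → ℕ} {z : κ → ℕ} {s t : ℕ} (hy : HasShape y s t) (hz : HasShape z s t)
    (h : ∑ j, y j = ∑ j, z j) : ∃ e : ι ≃ κ, ∀ j, z (e j) = y j := by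
  classical
  obtain ⟨a, b, c, hab, hac, hbc, hb, hc, h0⟩ := hy
  obtain ⟨a', b', c', hab', hac', hbc', hb', hc', h0'⟩ := hz
  obtain ⟨e, rfl, rfl, rfl⟩ := exists_equiv_three ‹_› hab hac hbc hab' hac' hbc'
  have hne : ∀ j, j ≠ a → z (e j) = y j := by
    intro j hj
    by_cases hjb : j = b
    · rw [hjb, hb, hb']
    by_cases hjc : j = c
    · rw [hjc, hc, hc']
    rw [h0 j hj hjb hjc, h0' _ (e.injective.ne hj) (e.injective.ne hjb) (e.injective.ne hjc)]
  refine ⟨e, fun j => ?_⟩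
  by_cases hj : j = a
  · rw [hj]
    rw [← e.sum_comp z, ← add_sum_erase _ _ (mem_univ a), ← add_sum_erase univ _ (mem_univ a),
      sum_congr rfl (s₂ := univ.erase a) (g := y) (f := fun j => z (e j))
        fun j hj => hne j (ne_of_mem_erase hj)] at h
    exact Nat.add_right_cancel h.symm
  · exact hne j hj

theorem sum_pow_succ_le [Fintype ι] {y : ι → ℕ} {m : ℕ} (hm : ∀ j, y j ≤ m) (k : ℕ) :
    ∑ j, y j ^ (k + 1) ≤ m * ∑ j, y j ^ k := by
  rw [mul_sum]
  refine sum_le_sum fun j _ => ?_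
  rw [pow_succ']
  exact Nat.mul_le_mul_right _ (hm j)

theorem sum_sq_le_sq_sum (u : Finset ι) (y : ι → ℕ) : ∑ j ∈ u, y j ^ 2 ≤ (∑ j ∈ u, y j) ^ 2 :=
  sum_sq_le_sq_sum_of_nonneg fun _ _ => Nat.zero_le _

theorem exists_third [Fintype ι] (h : 3 ≤ Fintype.card ι) (a b : ι) : ∃ c, a ≠ c ∧ b ≠ c := by
  classical
  obtain ⟨c, hc⟩ : ∃ c, c ∉ ({a, b} : Finset ι) := by
    by_contra hcon
    push Not at hcon
    have := (card_le_card (fun c _ => hcon c : univ ⊆ ({a, b} : Finset ι))).trans card_le_two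
    rw [card_univ] at this
    omega
  simp only [mem_insert, mem_singleton, not_or] at hc
  exact ⟨c, Ne.symm hc.1, Ne.symm hc.2⟩

/-- Split off a maximal value m and let r be the sum of the rest. If r ≤ 2 only the four shapes
occur; if r ≥ 3 the values are too spread out. The one tie is m = r = 3, where 3² + 3² = 4² + 1 + 1,
and there the cubes sum to at most 54, whereas the pattern (4,1,1) gives 66. -/
theorem hasShape_or_sum_sq_le [Fintype ι] (h3 : 3 ≤ Fintype.card ι) (y : ι → ℕ) {s : ℕ}
    (hs : ∑ j, y j = s + 2) (h1 : 1 ≤ s) :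
    HasShape y 0 0 ∨ HasShape y 1 0 ∨ HasShape y 2 0 ∨ HasShape y 1 1 ∨
      ∑ j, y j ^ 2 < s ^ 2 + 2 ∨ (s = 4 ∧ ∑ j, y j ^ 2 = 18 ∧ ∑ j, y j ^ 3 ≤ 54) := by
  classical
  have : Nonempty ι := Fintype.card_pos_iff.1 (by omega)
  obtain ⟨a, -, ha⟩ := exists_max_image univ y univ_nonempty
  have ha' : ∀ j, y j ≤ y a := fun j => ha j (mem_univ j)
  obtain ⟨m, hm⟩ : ∃ m, y a = m := ⟨_, rfl⟩
  obtain ⟨r, hr⟩ : ∃ r, ∑ j ∈ univ.erase a, y j = r := ⟨_, rfl⟩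
  have hsum : m + r = s + 2 := by rw [← hs, ← hm, ← hr, add_sum_erase _ _ (mem_univ a)]
  have zero_of : ∀ u : Finset ι, ∑ j ∈ u, y j = 0 → ∀ j ∈ u, y j = 0 := fun u hu =>
    sum_eq_zero_iff.1 hu
  have pick : ∀ u : Finset ι, ∑ j ∈ u, y j ≠ 0 →
      ∃ b ∈ u, 0 < y b ∧ y b + ∑ j ∈ u.erase b, y j = ∑ j ∈ u, y j := by
    intro u hu
    obtain ⟨b, hb, hb0⟩ := exists_ne_zero_of_sum_ne_zero hu
    exact ⟨b, hb, Nat.pos_of_ne_zero hb0, add_sum_erase _ _ hb⟩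
  have third := exists_third h3
  rcases Nat.lt_or_ge r 3 with hr3 | hr3
  · by_cases hr0 : r = 0
    · obtain ⟨b, hb, -⟩ := third a a
      obtain ⟨c, hac, hbc⟩ := third a b
      have hz := zero_of _ (hr.trans hr0)
      exact .inl ⟨a, b, c, hb, hac, hbc, hz b (by simp [hb.symm]), hz c (by simp [hac.symm]),
        fun j hj _ _ => hz j (by simp [hj])⟩
    obtain ⟨b, hb, hb0, hbs⟩ := pick _ (hr ▸ hr0)
    have hab : a ≠ b := fun h => by simp [h] at hb
    by_cases hrest : ∑ j ∈ (univ.erase a).erase b, y j = 0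
    · have hz := zero_of _ hrest
      obtain ⟨c, hac, hbc⟩ := third a b
      have hshape : HasShape y (y b) 0 := ⟨a, b, c, hab, hac, hbc, rfl,
        hz c (by simp [hac.symm, hbc.symm]), fun j h1 h2 _ => hz j (by simp [h1, h2])⟩
      obtain h | h : y b = 1 ∨ y b = 2 := by omega
      · exact .inr (.inl (h ▸ hshape))
      · exact .inr (.inr (.inl (h ▸ hshape)))
    · obtain ⟨c, hc, hc0, hcs⟩ := pick _ hrest
      simp only [mem_erase, mem_univ, and_true] at hc
      have hz := zero_of (((univ.erase a).erase b).erase c) (by omega)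
      exact .inr (.inr (.inr (.inl ⟨a, b, c, hab, Ne.symm hc.2, Ne.symm hc.1, by omega, by omega,
        fun j h1 h2 h3 => hz j (by simp [h1, h2, h3])⟩)))
  -- `b1` is efficient when the maximum is less than half the total, `b2` when it is at least half.
  · have b1 : ∑ j, y j ^ 2 ≤ m * (s + 2) := by
      have := sum_pow_succ_le ha' 1
      simpa [hs, hm] using this
    have b2 : ∑ j, y j ^ 2 ≤ m ^ 2 + r ^ 2 := by
      rw [← add_sum_erase _ _ (mem_univ a), hm, ← hr]
      exact Nat.add_le_add_left (sum_sq_le_sq_sum _ _) _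
    have b3 : ∑ j, y j ^ 3 ≤ m * ∑ j, y j ^ 2 := hm ▸ sum_pow_succ_le ha' 2
    refine .inr (.inr (.inr (.inr ?_)))
    generalize ∑ j, y j ^ 2 = A at *
    generalize ∑ j, y j ^ 3 = B at *
    rcases Nat.lt_or_ge m r with hmr | hmr
    · left
      have : 2 * m ≤ s + 1 := by omega
      rcases Nat.lt_or_ge s 3 with hs3 | hs3
      · have : m ≤ 1 := by omega
        have : m * (s + 2) ≤ 1 * (s + 2) := Nat.mul_le_mul_right _ this
        interval_cases s <;> omega
      · nlinarith
    -- With r = 3 + u and m = 3 + u + v, the gap s² + 2 - (m² + r²) equals 2u² + 4u + 2v + 2uv,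
    -- which vanishes only for u = v = 0.
    · obtain ⟨u, rfl⟩ := Nat.exists_eq_add_of_le hr3
      obtain ⟨v, rfl⟩ := Nat.exists_eq_add_of_le hmr
      obtain rfl : s = 4 + 2 * u + v := by omega
      by_cases h0 : u = 0 ∧ v = 0
      · obtain ⟨rfl, rfl⟩ := h0
        norm_num at *
        omega
      · left
        have : 1 ≤ u + v := by omega
        nlinarith

/-- Forbidding one value from taking the whole total leaves (s+1, 1) as the best pattern and (s, 2)
as the next. -/
theorem sum_sq_le_of_lt [Fintype ι] (h3 : 3 ≤ Fintype.card ι) {y : ι → ℕ} {s : ℕ}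
    (hs : ∑ j, y j = s + 2) (h1 : 1 ≤ s) (hlt : ∀ j, y j ≤ s + 1) :
    ∑ j, y j ^ 2 ≤ (s + 1) ^ 2 + 1 ∧ (¬ HasShape y 1 0 → ∑ j, y j ^ 2 ≤ s ^ 2 + 4) := by
  rcases hasShape_or_sum_sq_le h3 y hs h1 with h | h | h | h | h | ⟨rfl, h, -⟩
  · obtain ⟨a, ha, -⟩ := h.exists_sum_pow
    have := hlt a
    omega
  · obtain ⟨a, ha, hsq⟩ := h.exists_sum_pow
    refine ⟨?_, fun hn => absurd h hn⟩
    have hsq := hsq 1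
    norm_num at hsq
    rw [hsq, show y a = s + 1 by omega]
  · obtain ⟨a, ha, hsq⟩ := h.exists_sum_pow
    have hsq := hsq 1
    norm_num at hsq
    rw [hsq, show y a = s by omega]
    exact ⟨by nlinarith, fun _ => le_rfl⟩
  · obtain ⟨a, ha, hsq⟩ := h.exists_sum_pow
    have hsq := hsq 1
    norm_num at hsq
    rw [hsq, show y a = s by omega]
    exact ⟨by nlinarith, fun _ => by omega⟩
  · exact ⟨by nlinarith, fun _ => by omega⟩
  · rw [h]; norm_num

end

/-! ### Classification by the presence of a full vertex -/

section
variable {α β : Type*} [Fintype α]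

/-- `R` is the relation of a tree in which one white vertex is joined to all black vertices, of
which one carries `s` white leaves, one `t` white leaves, and one all the remaining ones. -/
def IsHostRel (R : α → β → Prop) (s t : ℕ) : Prop :=
  ∃ (g : α → Option β) (c : α), (∀ i, g i = none ↔ i = c) ∧ HasShape (load g) s t ∧ R = hostRel g

theorem IsHostRel.nonempty_left {R : α → β → Prop} {s t : ℕ} (h : IsHostRel R s t) : Nonempty α := by
  obtain ⟨g, c, -⟩ := h
  exact ⟨c⟩

theorem IsHostRel.nonempty_right {R : α → β → Prop} {s t : ℕ} (h : IsHostRel R s t) : Nonempty β := by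
  obtain ⟨g, c, -, ⟨a, -⟩, -⟩ := h
  exact ⟨a⟩

end

theorem rowDeg_le {α β : Type*} [Fintype β] (R : α → β → Prop) (i : α) : rowDeg R i ≤ Fintype.card β :=
  card_le_univ _

section
variable {α β α' β' : Type*} [Fintype α] [Fintype β] [Fintype α'] [Fintype β']

/-- The value of `excessSq` on a relation with `IsHostRel`. -/
def hostFour (Q m s t : ℕ) : ℕ := Q ^ 2 + (m ^ 2 + s ^ 2 + t ^ 2)

/-- Half the sixth spectral moment of a tree with `IsHostRel`. -/
def hostSix (P Q m s t : ℕ) : ℕ :=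
  (Q + 1) ^ 3 + 3 * (Q + 1) * P + 3 * (m ^ 2 + s ^ 2 + t ^ 2) + (m ^ 3 + s ^ 3 + t ^ 3)

variable {R : α → β → Prop} {R' : α' → β' → Prop} {P Q P' Q' m m' s t s' t' : ℕ}

theorem IsHostRel.isTree (h : IsHostRel R s t) : (bip R).IsTree := by
  obtain ⟨g, c, hc, -, rfl⟩ := h
  exact isTree_hostRel hc

theorem IsHostRel.nonempty_iso (h : IsHostRel R s t) (h' : IsHostRel R' s t)
    (hα : Fintype.card α = Fintype.card α') (hβ : Fintype.card β = Fintype.card β') :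
    Nonempty (bip R ≃g bip R') := by
  obtain ⟨g, c, hc, hs, rfl⟩ := h
  obtain ⟨g', c', hc', hs', rfl⟩ := h'
  have h1 := sum_load hc
  have h2 := sum_load hc'
  obtain ⟨e, he⟩ := hs.exists_equiv hβ hs' (by omega)
  exact nonempty_iso_hostRel hc hc' e he

theorem IsHostRel.excessSq_eq (h : IsHostRel R s t) (hα : Fintype.card α = P + 1)
    (hβ : Fintype.card β = Q + 1) (hm : m + s + t = P) : excessSq R = hostFour Q m s t := by
  obtain ⟨g, c, hc, hs, rfl⟩ := h
  have h1 := sum_load hc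
  obtain ⟨a, ha, hk⟩ := hs.exists_sum_pow
  have := hk 1
  norm_num at this
  rw [excessSq_hostRel hc, hβ, this, show load g a = m by omega]
  rfl

theorem IsHostRel.spectralMoment_six (h : IsHostRel R s t) (hα : Fintype.card α = P + 1)
    (hβ : Fintype.card β = Q + 1) (hm : m + s + t = P) :
    spectralMoment (bip R) 6 = 2 * (hostSix P Q m s t : ℕ) := by
  obtain ⟨g, c, hc, hs, rfl⟩ := h
  have h1 := sum_load hc
  obtain ⟨a, ha, hk⟩ := hs.exists_sum_pow
  have h2 := hk 1
  have h3 := hk 2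
  norm_num at h2 h3
  rw [spectralMoment_hostRel_six hc, hβ, h2, h3, show load g a = m by omega,
    show ∑ j, load g j = P by omega, hostSix]
  push_cast
  ring

theorem IsHostRel.sLt (h : IsHostRel R s t) (h' : IsHostRel R' s' t')
    (hα : Fintype.card α = P + 1) (hβ : Fintype.card β = Q + 1) (hα' : Fintype.card α' = P' + 1)
    (hβ' : Fintype.card β' = Q' + 1) (hm : m + s + t = P) (hm' : m' + s' + t' = P')
    (hc : P + Q = P' + Q') (hn : 5 ≤ P + Q)
    (hlt : hostFour Q m s t < hostFour Q' m' s' t' ∨ hostFour Q m s t = hostFour Q' m' s' t' ∧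
      hostSix P Q m s t < hostSix P' Q' m' s' t') : SLt (bip R) (bip R') := by
  have := h.nonempty_left
  have := h.nonempty_right
  have := h'.nonempty_left
  have := h'.nonempty_right
  have hcard : Fintype.card (α ⊕ β) = Fintype.card (α' ⊕ β') := by
    simp only [Fintype.card_sum]
    omega
  have hcard' : 6 < Fintype.card (α ⊕ β) := by
    simp only [Fintype.card_sum]
    omega
  rcases hlt with hlt | ⟨heq, hlt⟩
  · refine sLt_of_excessSq_lt h.isTree h'.isTree hcard (by omega) ?_
    rwa [h.excessSq_eq hα hβ hm, h'.excessSq_eq hα' hβ' hm']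
  · refine sLt_of_excessSq_eq h.isTree h'.isTree hcard hcard' ?_ ?_
    · rwa [h.excessSq_eq hα hβ hm, h'.excessSq_eq hα' hβ' hm']
    · rw [h.spectralMoment_six hα hβ hm, h'.spectralMoment_six hα' hβ' hm']
      have : (hostSix P Q m s t : ℝ) < hostSix P' Q' m' s' t' := by exact_mod_cast hlt
      linarith

theorem sum_rowDeg_sub_one (h : (bip R).IsTree) (hα : Fintype.card α = P + 1)
    (hβ : Fintype.card β = Q + 1) : ∑ i, (rowDeg R i - 1) = Q := by
  have : Nonempty β := Fintype.card_pos_iff.1 (by omega)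
  have h1 := sum_sub_one (rowDeg R) (rowDeg_pos h)
  have h2 := sum_rowDeg h
  omega

/-- Trees in which some white vertex is adjacent to all black ones. -/
theorem classify_of_rowDeg_eq (h : (bip R).IsTree) {c : α} (hd : rowDeg R c = Fintype.card β)
    (hα : Fintype.card α = m + 3) (hβ : Fintype.card β = Q + 1) (hm : 1 ≤ m) (hQ : 2 ≤ Q) :
    IsHostRel R 0 0 ∨ IsHostRel R 1 0 ∨ IsHostRel R 2 0 ∨ IsHostRel R 1 1 ∨
      excessSq R < hostFour Q m 1 1 ∨ excessSq R = hostFour Q m 1 1 ∧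
        spectralMoment (bip R) 6 < 2 * (hostSix (m + 2) Q m 1 1 : ℕ) := by
  have : Nonempty β := Fintype.card_pos_iff.1 (by omega)
  obtain ⟨g, hc, rfl⟩ := exists_eq_hostRel h hd
  have hs := sum_load hc
  have hE := excessSq_hostRel hc
  have hS := spectralMoment_hostRel_six hc
  rw [hβ, Nat.add_sub_cancel] at hE
  rcases hasShape_or_sum_sq_le (by omega) (load g) (s := m) (by omega) hm with
    h | h | h | h | h | ⟨rfl, h2, h3⟩
  · exact .inl ⟨g, c, hc, h, rfl⟩
  · exact .inr (.inl ⟨g, c, hc, h, rfl⟩)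
  · exact .inr (.inr (.inl ⟨g, c, hc, h, rfl⟩))
  · exact .inr (.inr (.inr (.inl ⟨g, c, hc, h, rfl⟩)))
  · refine .inr (.inr (.inr (.inr (.inl ?_))))
    rw [hE, hostFour]
    omega
  -- The exceptional tie: S_4 agrees with that of loads (4,1,1), and the sum of cubes makes S_6
  -- smaller.
  · refine .inr (.inr (.inr (.inr (.inr ⟨?_, ?_⟩))))
    · rw [hE, h2, hostFour]
      norm_num
    · have h3' : ((∑ j, load g j ^ 3 : ℕ) : ℝ) ≤ 54 := by exact_mod_cast h3
      rw [hS, h2, hβ, show ∑ j, load g j = 6 by omega, hostSix]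
      push_cast at *
      linarith

/-- Trees in which no white vertex is adjacent to all black ones. -/
theorem classify_of_rowDeg_ne (h : (bip R).IsTree) (hd : ∀ i, rowDeg R i ≠ Fintype.card β)
    (hα : Fintype.card α = s + 3) (hβ : Fintype.card β = t + 3) (hs : 1 ≤ s) (hst : s < t) :
    IsHostRel (flip R) 1 0 ∨
      excessSq R < hostFour (s + 2) (t + 1) 1 0 ∧ excessSq R < hostFour (t + 2) s 2 0 := by
  have : Nonempty α := Fintype.card_pos_iff.1 (by omega)
  have : Nonempty β := Fintype.card_pos_iff.1 (by omega)
  simp only [hostFour]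
  by_cases hcol : ∃ j, colDeg R j = Fintype.card α
  · obtain ⟨c, hcc⟩ := hcol
    have h' := isTree_flip h
    obtain ⟨g, hc, hg⟩ := exists_eq_hostRel h' hcc
    have hsum := sum_load hc
    have hE := excessSq_hostRel hc
    rw [← hg, excessSq_flip, hα] at hE
    -- A load of t + 2 would give a white vertex adjacent to all black ones (the double star), which
    -- `hd` excludes.
    have hlt : ∀ i, load g i ≤ t + 1 := by
      intro i
      have h1 := colDeg_hostRel hc i
      rw [← hg] at h1
      have h2 := hd i
      have h3 := rowDeg_le R i
      change rowDeg R i = _ at h1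
      omega
    have hle := (sum_sq_le_of_lt (by omega) (y := load g) (s := t) (by omega) (by omega) hlt).2
    by_cases hshape : HasShape (load g) 1 0
    · exact .inl ⟨g, c, hc, hshape, hg⟩
    · right
      have := hle hshape
      rw [hE, show s + 3 - 1 = s + 2 from rfl]
      -- The bound (s+2)² + t² + 4 is below the first value because t > 1 and below the second
      -- because s < t.
      constructor <;> nlinarith
  · push Not at hcol
    right
    have hx := sum_rowDeg_sub_one h hα hβ
    have hy := sum_rowDeg_sub_one (isTree_flip h) hβ hα
    have h1 := (sum_sq_le_of_lt (by omega) hx (by omega) fun i => by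
      have := hd i
      have := rowDeg_le R i
      omega).1
    have h2 := (sum_sq_le_of_lt (by omega) hy (by omega) fun j => by
      have : rowDeg (flip R) j ≠ _ := hcol j
      have := rowDeg_le (flip R) j
      omega).1
    have hE : excessSq R = ∑ i, (rowDeg R i - 1) ^ 2 + ∑ j, (rowDeg (flip R) j - 1) ^ 2 := rfl
    rw [hE]
    constructor <;> nlinarith

end

/-! ### The named trees and their pairwise comparison -/

theorem treeB_eq_bip (p q k l : ℕ) :
    treeB p q k l = bip fun (i : Fin p) (j : Fin q) => adjB k l i j := by
  ext x y
  cases x <;> cases y <;> rfl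

theorem treeD_eq_bip (p q k l : ℕ) :
    treeD p q k l = bip (flip fun (i : Fin q) (j : Fin p) => adjB k l i j) := by
  ext x y
  cases x <;> cases y <;> rfl

/-- Host indices are at most l + 1, hence below q. The condition `0 < i.val` discards the centre, to
which `hostB` also assigns a value. -/
theorem isHostRel_adjB {p q k l s t : ℕ} (hp : 0 < p) (hq : l + 2 ≤ q)
    (h : ∀ f : Fin q → ℕ, (∀ j, f j = #{i : Fin p | 0 < i.val ∧ hostB k l i = j}) →
      HasShape f s t) :
    IsHostRel (fun (i : Fin p) (j : Fin q) => adjB k l i j) s t := by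
  have hb : ∀ i, hostB k l i < q := by
    intro i
    unfold hostB
    split_ifs <;> omega
  let g : Fin p → Option (Fin q) := fun i =>
    if i.val = 0 then none else some ⟨hostB k l i, hb i⟩
  refine ⟨g, ⟨0, hp⟩, fun i => by simp [g, Fin.ext_iff], h _ fun j => ?_, ?_⟩
  · rw [load]
    congr 1
    ext i
    simp [g, Fin.ext_iff, Nat.pos_iff_ne_zero]
  · ext i j
    by_cases hi : i.val = 0
    · simp [g, hostRel, adjB, hi]
    · simp [g, hostRel, adjB, hi, Fin.ext_iff, eq_comm]

theorem isHostRel_adjB_zero_zero {p q : ℕ} (hp : 4 ≤ p) (hq : 4 ≤ q) :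
    IsHostRel (fun (i : Fin p) (j : Fin q) => adjB 0 0 i j) 0 0 := by
  refine isHostRel_adjB (by omega) (by omega) fun f hf => ?_
  have h0 : ∀ j : Fin q, j.val ≠ 0 → f j = 0 := by
    intro j hj
    rw [hf, card_eq_zero, filter_eq_empty_iff]
    rintro i - ⟨hi, h⟩
    rw [hostB, if_neg (by omega), if_neg (by omega)] at h
    exact hj h.symm
  exact ⟨⟨0, by omega⟩, ⟨1, by omega⟩, ⟨2, by omega⟩, by simp, by simp, by simp, h0 _ (by simp),
    h0 _ (by simp), fun j h _ _ => h0 j fun hj => h (Fin.ext hj)⟩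

theorem isHostRel_adjB_zero_one {p q : ℕ} (hp : 4 ≤ p) (hq : 4 ≤ q) :
    IsHostRel (fun (i : Fin p) (j : Fin q) => adjB 0 1 i j) 1 0 := by
  refine isHostRel_adjB (by omega) (by omega) fun f hf => ?_
  have h0 : ∀ j : Fin q, j.val ≠ 0 → j.val ≠ 2 → f j = 0 := by
    intro j hj hj2
    rw [hf, card_eq_zero, filter_eq_empty_iff]
    rintro i - ⟨hi, h⟩
    unfold hostB at h
    split_ifs at h <;> omega
  -- For k = 0 the numbering of `hostB` skips black vertex 1: the first single leaf sits on vertex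
  -- 2.
  have h2 : f ⟨2, by omega⟩ = 1 := by
    rw [hf, card_eq_one]
    refine ⟨⟨1, by omega⟩, ?_⟩
    ext i
    rw [mem_filter]
    simp only [mem_univ, true_and, mem_singleton, Fin.ext_iff, hostB]
    split_ifs <;> first | omega | (simp only [and_false, false_iff]; omega)
  exact ⟨⟨0, by omega⟩, ⟨2, by omega⟩, ⟨1, by omega⟩, by simp, by simp, by simp, h2,
    h0 _ (by simp) (by simp), fun j h h' _ => h0 j (fun hj => h (Fin.ext hj))
      (fun hj => h' (Fin.ext hj))⟩

theorem isHostRel_adjB_two_zero {p q : ℕ} (hp : 4 ≤ p) (hq : 4 ≤ q) :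
    IsHostRel (fun (i : Fin p) (j : Fin q) => adjB 2 0 i j) 2 0 := by
  refine isHostRel_adjB (by omega) (by omega) fun f hf => ?_
  have h0 : ∀ j : Fin q, j.val ≠ 0 → j.val ≠ 1 → f j = 0 := by
    intro j hj hj1
    rw [hf, card_eq_zero, filter_eq_empty_iff]
    rintro i - ⟨hi, h⟩
    unfold hostB at h
    split_ifs at h <;> omega
  have h1 : f ⟨1, by omega⟩ = 2 := by
    rw [hf, card_eq_two]
    refine ⟨⟨1, by omega⟩, ⟨2, by omega⟩, by simp, ?_⟩
    ext i
    rw [mem_filter]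
    simp only [mem_univ, true_and, mem_insert, mem_singleton, Fin.ext_iff, hostB]
    split_ifs <;> first | omega | (simp only [and_false, false_iff]; omega)
  exact ⟨⟨0, by omega⟩, ⟨1, by omega⟩, ⟨2, by omega⟩, by simp, by simp, by simp, h1,
    h0 _ (by simp) (by simp), fun j h h' _ => h0 j (fun hj => h (Fin.ext hj))
      (fun hj => h' (Fin.ext hj))⟩

theorem isHostRel_adjB_zero_two {p q : ℕ} (hp : 4 ≤ p) (hq : 4 ≤ q) :
    IsHostRel (fun (i : Fin p) (j : Fin q) => adjB 0 2 i j) 1 1 := by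
  refine isHostRel_adjB (by omega) (by omega) fun f hf => ?_
  have h0 : ∀ j : Fin q, j.val ≠ 0 → j.val ≠ 2 → j.val ≠ 3 → f j = 0 := by
    intro j hj hj2 hj3
    rw [hf, card_eq_zero, filter_eq_empty_iff]
    rintro i - ⟨hi, h⟩
    unfold hostB at h
    split_ifs at h <;> omega
  have h2 : f ⟨2, by omega⟩ = 1 := by
    rw [hf, card_eq_one]
    refine ⟨⟨1, by omega⟩, ?_⟩
    ext i
    rw [mem_filter]
    simp only [mem_univ, true_and, mem_singleton, Fin.ext_iff, hostB]
    split_ifs <;> first | omega | (simp only [and_false, false_iff]; omega)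
  have h3 : f ⟨3, by omega⟩ = 1 := by
    rw [hf, card_eq_one]
    refine ⟨⟨2, by omega⟩, ?_⟩
    ext i
    rw [mem_filter]
    simp only [mem_univ, true_and, mem_singleton, Fin.ext_iff, hostB]
    split_ifs <;> first | omega | (simp only [and_false, false_iff]; omega)
  exact ⟨⟨0, by omega⟩, ⟨2, by omega⟩, ⟨3, by omega⟩, by simp, by simp, by simp, h2, h3,
    fun j h h' h'' => h0 j (fun hj => h (Fin.ext hj)) (fun hj => h' (Fin.ext hj))
      (fun hj => h'' (Fin.ext hj))⟩

theorem exists_iso_bip {V : Type*} [Fintype V] {T : SimpleGraph V} {p q : ℕ}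
    (h : IsBipartitionTree p q T) :
    ∃ (A : Set V) (_ : Fintype A) (_ : Fintype (Aᶜ : Set V)) (R : A → (Aᶜ : Set V) → Prop),
      Fintype.card A = p ∧ Fintype.card (Aᶜ : Set V) = q ∧ Nonempty (T ≃g bip R) := by
  obtain ⟨-, A, hA, hp, hq⟩ := h
  have hfA := Fintype.ofFinite A
  have hfA' := Fintype.ofFinite (Aᶜ : Set V)
  refine ⟨A, hfA, hfA', _, ?_, ?_, nonempty_iso_bip hA⟩
  · rw [← Nat.card_eq_fintype_card, Nat.card_coe_set_eq, hp]
  · rw [← Nat.card_eq_fintype_card, Nat.card_coe_set_eq, hq]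

theorem nonempty_iso_treeB {α β : Type*} [Fintype α] [Fintype β] {R : α → β → Prop}
    {p q k l s t : ℕ} (hα : Fintype.card α = p) (hβ : Fintype.card β = q) (h : IsHostRel R s t)
    (h' : IsHostRel (fun (i : Fin p) (j : Fin q) => adjB k l i j) s t) :
    Nonempty (bip R ≃g treeB p q k l) := by
  rw [treeB_eq_bip]
  exact h.nonempty_iso h' (by simpa) (by simpa)

theorem sLt_treeB_treeB {p q k l s t k' l' s' t' m m' P Q : ℕ} (hp : p = P + 1) (hq : q = Q + 1)
    (h : IsHostRel (fun (i : Fin p) (j : Fin q) => adjB k l i j) s t)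
    (h' : IsHostRel (fun (i : Fin p) (j : Fin q) => adjB k' l' i j) s' t')
    (hm : m + s + t = P) (hm' : m' + s' + t' = P) (hn : 5 ≤ P + Q)
    (hlt : hostFour Q m s t < hostFour Q m' s' t') : SLt (treeB p q k l) (treeB p q k' l') := by
  rw [treeB_eq_bip, treeB_eq_bip]
  exact h.sLt h' (by simpa) (by simpa) (by simpa) (by simpa) hm hm' rfl hn (.inl hlt)

theorem sLt_treeB_treeD {p q k l s t k' l' s' t' m m' P Q : ℕ} (hp : p = P + 1) (hq : q = Q + 1)
    (h : IsHostRel (fun (i : Fin p) (j : Fin q) => adjB k l i j) s t)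
    (h' : IsHostRel (fun (i : Fin q) (j : Fin p) => adjB k' l' i j) s' t')
    (hm : m + s + t = P) (hm' : m' + s' + t' = Q) (hn : 5 ≤ P + Q)
    (hlt : hostFour Q m s t < hostFour P m' s' t') :
    SLt (treeB p q k l) (treeD p q k' l') := by
  rw [treeB_eq_bip, treeD_eq_bip]
  exact (h.sLt h' (by simpa) (by simpa) (by simpa) (by simpa) hm hm' (by omega) hn
    (.inl hlt)).congr_right (bipFlip _)

theorem sLt_treeD_treeB {p q k l s t k' l' s' t' m m' P Q : ℕ} (hp : p = P + 1) (hq : q = Q + 1)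
    (h : IsHostRel (fun (i : Fin q) (j : Fin p) => adjB k l i j) s t)
    (h' : IsHostRel (fun (i : Fin p) (j : Fin q) => adjB k' l' i j) s' t')
    (hm : m + s + t = Q) (hm' : m' + s' + t' = P) (hn : 5 ≤ P + Q)
    (hlt : hostFour P m s t < hostFour Q m' s' t' ∨ hostFour P m s t = hostFour Q m' s' t' ∧
      hostSix Q P m s t < hostSix P Q m' s' t') :
    SLt (treeD p q k l) (treeB p q k' l') := by
  rw [treeB_eq_bip, treeD_eq_bip]
  exact (h.sLt h' (by simpa) (by simpa) (by simpa) (by simpa) hm hm' (by omega) (by omega)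
    hlt).congr_left (bipFlip _).symm

/-! ### Full classification and the main theorem -/

/-- Every tree with a `(p, q)`-bipartition is one of five trees or lies below one of them. -/
theorem classify_tree {V : Type*} [Fintype V] {T : SimpleGraph V} {p q : ℕ} (hp : 4 ≤ p)
    (hpq : p < q) (h : IsBipartitionTree p q T) :
    Nonempty (T ≃g treeB p q 0 0) ∨ Nonempty (T ≃g treeB p q 0 1) ∨
      Nonempty (T ≃g treeB p q 2 0) ∨ Nonempty (T ≃g treeB p q 0 2) ∨
      Nonempty (T ≃g treeD p q 0 1) ∨ SLt T (treeB p q 0 2) ∨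
      (SLt T (treeD p q 0 1) ∧ SLt T (treeB p q 2 0)) := by
  obtain ⟨A, _, _, R, hα, hβ, ⟨e⟩⟩ := exists_iso_bip h
  have hR : (bip R).IsTree := e.isTree_iff.1 h.1
  obtain ⟨s, rfl⟩ := Nat.exists_eq_add_of_le' hp
  obtain ⟨t, rfl⟩ := Nat.exists_eq_add_of_le' (hp.trans hpq.le)
  have : Nonempty A := Fintype.card_pos_iff.1 (by omega)
  have : Nonempty (Aᶜ : Set V) := Fintype.card_pos_iff.1 (by omega)
  have transfer : ∀ {W : Type} {H : SimpleGraph W}, Nonempty (bip R ≃g H) → Nonempty (T ≃g H) :=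
    fun ⟨f⟩ => ⟨e.trans f⟩
  have hc : Fintype.card (A ⊕ (Aᶜ : Set V)) = Fintype.card (Fin (s + 4) ⊕ Fin (t + 4)) := by
    simp [hα, hβ]
  have hc' : Fintype.card (A ⊕ (Aᶜ : Set V)) = Fintype.card (Fin (t + 4) ⊕ Fin (s + 4)) := by
    rw [hc]
    simp only [Fintype.card_sum, Fintype.card_fin]
    omega
  have hn : 6 < Fintype.card (A ⊕ (Aᶜ : Set V)) := by
    rw [hc]
    simp only [Fintype.card_sum, Fintype.card_fin]
    omega
  have h02 := isHostRel_adjB_zero_two hp (hp.trans hpq.le)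
  have h20 := isHostRel_adjB_two_zero hp (hp.trans hpq.le)
  have h01 := isHostRel_adjB_zero_one (hp.trans hpq.le) hp
  by_cases hd : ∃ c, rowDeg R c = Fintype.card (Aᶜ : Set V)
  · obtain ⟨c, hd⟩ := hd
    rcases classify_of_rowDeg_eq hR hd (m := s + 1) (Q := t + 3) hα hβ (by omega) (by omega) with
      h | h | h | h | h | ⟨h, h'⟩
    · exact .inl (transfer (nonempty_iso_treeB hα hβ h (isHostRel_adjB_zero_zero (by omega)
        (by omega))))
    · exact .inr (.inl (transfer (nonempty_iso_treeB hα hβ h (isHostRel_adjB_zero_one (by omega)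
        (by omega)))))
    · exact .inr (.inr (.inl (transfer (nonempty_iso_treeB hα hβ h h20))))
    · exact .inr (.inr (.inr (.inl (transfer (nonempty_iso_treeB hα hβ h h02)))))
    · refine .inr (.inr (.inr (.inr (.inr (.inl (SLt.congr_left e ?_))))))
      rw [treeB_eq_bip]
      refine sLt_of_excessSq_lt hR h02.isTree hc (by omega) ?_
      rwa [h02.excessSq_eq (P := s + 3) (Q := t + 3) (m := s + 1) (by simp) (by simp) (by omega)]
    · refine .inr (.inr (.inr (.inr (.inr (.inl (SLt.congr_left e ?_))))))
      rw [treeB_eq_bip]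
      refine sLt_of_excessSq_eq hR h02.isTree hc hn ?_ ?_
      · rwa [h02.excessSq_eq (P := s + 3) (Q := t + 3) (m := s + 1) (by simp) (by simp)
          (by omega)]
      · rwa [h02.spectralMoment_six (P := s + 3) (Q := t + 3) (m := s + 1) (by simp) (by simp)
          (by omega)]
  · push Not at hd
    rcases classify_of_rowDeg_ne hR hd (s := s + 1) (t := t + 1) hα hβ (by omega) (by omega) with
      h | ⟨h, h'⟩
    · refine .inr (.inr (.inr (.inr (.inl (transfer ?_)))))
      obtain ⟨f⟩ := h.nonempty_iso h01 (by simpa using hβ) (by simpa using hα)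
      rw [treeD_eq_bip]
      exact ⟨((bipFlip R).trans f).trans (bipFlip _)⟩
    · refine .inr (.inr (.inr (.inr (.inr (.inr ⟨SLt.congr_left e ?_, SLt.congr_left e ?_⟩)))))
      · rw [treeD_eq_bip]
        refine SLt.congr_right (bipFlip _) (sLt_of_excessSq_lt hR h01.isTree hc' (by omega) ?_)
        rwa [h01.excessSq_eq (P := t + 3) (Q := s + 3) (m := t + 2) (by simp) (by simp)
          (by omega)]
      · rw [treeB_eq_bip]
        refine sLt_of_excessSq_lt hR h20.isTree hc (by omega) ?_
        rwa [h20.excessSq_eq (P := s + 3) (Q := t + 3) (m := s + 1) (by simp) (by simp)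
          (by omega)]

theorem isBipartitionTree_treeB {p q k l s t : ℕ}
    (h : IsHostRel (fun (i : Fin p) (j : Fin q) => adjB k l i j) s t) :
    IsBipartitionTree p q (treeB p q k l) := by
  rw [treeB_eq_bip]
  exact isBipartitionTree_bip _ (by simp) (by simp) h.isTree

theorem isBipartitionTree_treeD {p q k l s t : ℕ}
    (h : IsHostRel (fun (i : Fin q) (j : Fin p) => adjB k l i j) s t) :
    IsBipartitionTree p q (treeD p q k l) := by
  rw [treeD_eq_bip]
  exact isBipartitionTree_bip _ (by simp) (by simp) (isTree_flip h.isTree)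

theorem sLe_and_sEq_iff {V W : Type*} [Fintype V] [Fintype W] {T : SimpleGraph V}
    {H : SimpleGraph W} (h : Nonempty (T ≃g H) ∨ SLt T H) :
    SLe T H ∧ (SEq T H ↔ Nonempty (T ≃g H)) := by
  rcases h with h | h
  · have hs : SEq T H := sEq_of_iso h.some
    exact ⟨.inr hs, fun _ => h, fun _ => hs⟩
  · exact ⟨.inl h, fun h' => absurd h' h.not_sEq, fun ⟨e⟩ => (h.isEmpty_iso.false e).elim⟩

theorem theorem2p4 (p q : ℕ) (hp : 4 ≤ p) (hpq : p < q) :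
    ((p : ℝ) > ((q : ℝ) + 4) / 2 →
      IsRemainingTree p q {treeB p q 0 0, treeB p q 0 1, treeD p q 0 1} (treeB p q 2 0) ∧
      ∀ (V : Type*) [Fintype V] (T : SimpleGraph V),
        IsRemainingTree p q {treeB p q 0 0, treeB p q 0 1, treeD p q 0 1} T →
          SLe T (treeB p q 2 0) ∧ (SEq T (treeB p q 2 0) ↔ Nonempty (T ≃g treeB p q 2 0))) ∧
    ((p : ℝ) = ((q : ℝ) + 4) / 2 →
      IsRemainingTree p q {treeB p q 0 0, treeB p q 0 1, treeB p q 2 0} (treeD p q 0 1) ∧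
      ∀ (V : Type*) [Fintype V] (T : SimpleGraph V),
        IsRemainingTree p q {treeB p q 0 0, treeB p q 0 1, treeB p q 2 0} T →
          SLe T (treeD p q 0 1) ∧ (SEq T (treeD p q 0 1) ↔ Nonempty (T ≃g treeD p q 0 1))) ∧
    ((p : ℝ) < ((q : ℝ) + 4) / 2 →
      IsRemainingTree p q {treeB p q 0 0, treeB p q 0 1, treeB p q 2 0} (treeB p q 0 2) ∧
      ∀ (V : Type*) [Fintype V] (T : SimpleGraph V),
        IsRemainingTree p q {treeB p q 0 0, treeB p q 0 1, treeB p q 2 0} T →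
          SLe T (treeB p q 0 2) ∧ (SEq T (treeB p q 0 2) ↔ Nonempty (T ≃g treeB p q 0 2))) := by
  have hq : 4 ≤ q := hp.trans hpq.le
  have h00 := isHostRel_adjB_zero_zero hp hq
  have h01 := isHostRel_adjB_zero_one hp hq
  have h20 := isHostRel_adjB_two_zero hp hq
  have h02 := isHostRel_adjB_zero_two hp hq
  have d01 := isHostRel_adjB_zero_one hq hp
  -- In terms of a = p - 4 and b = q - 4, comparing p with (q + 4)/2 means comparing 2a with b.
  obtain ⟨a, ha⟩ : ∃ a, p = a + 4 := Nat.exists_eq_add_of_le' hp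
  obtain ⟨b, hb⟩ : ∃ b, q = b + 4 := Nat.exists_eq_add_of_le' hq
  have hab : a < b := by omega
  have hP : p = (a + 3) + 1 := ha
  have hQ : q = (b + 3) + 1 := hb
  have lt_0220 : SLt (treeB p q 0 2) (treeB p q 2 0) :=
    sLt_treeB_treeB hP hQ h02 h20 (m := a + 1) (m' := a + 1) (by omega) (by omega) (by omega)
      (by simp only [hostFour]; nlinarith)
  refine ⟨fun h => ?_, fun h => ?_, fun h => ?_⟩
  · have h2 : b < 2 * a := by
      have h' : (q : ℝ) + 4 < 2 * p := by linarith
      have h'' : q + 4 < 2 * p := by exact_mod_cast h'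
      omega
    have lt_00 : SLt (treeB p q 2 0) (treeB p q 0 0) :=
      sLt_treeB_treeB hP hQ h20 h00 (m := a + 1) (m' := a + 3) (by omega) (by omega) (by omega)
        (by simp only [hostFour]; nlinarith)
    have lt_01 : SLt (treeB p q 2 0) (treeB p q 0 1) :=
      sLt_treeB_treeB hP hQ h20 h01 (m := a + 1) (m' := a + 2) (by omega) (by omega) (by omega)
        (by simp only [hostFour]; nlinarith)
    have lt_d : SLt (treeB p q 2 0) (treeD p q 0 1) :=
      sLt_treeB_treeD hP hQ h20 d01 (m := a + 1) (m' := b + 2) (by omega) (by omega) (by omega)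
        (by simp only [hostFour]; nlinarith)
    refine ⟨⟨isBipartitionTree_treeB h20, ?_⟩, fun V _ T ⟨hT, hne⟩ => sLe_and_sEq_iff ?_⟩
    · rintro G (rfl | rfl | rfl)
      exacts [lt_00.isEmpty_iso, lt_01.isEmpty_iso, lt_d.isEmpty_iso]
    · rcases classify_tree hp hpq hT with ⟨⟨e⟩⟩ | ⟨⟨e⟩⟩ | e | ⟨⟨e⟩⟩ | ⟨⟨e⟩⟩ | h | ⟨-, h⟩
      · exact ((hne _ (by simp)).false e).elim
      · exact ((hne _ (by simp)).false e).elim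
      · exact .inl e
      · exact .inr (lt_0220.congr_left e)
      · exact ((hne _ (by simp)).false e).elim
      · exact .inr (h.trans lt_0220)
      · exact .inr h
  · have h2 : b = 2 * a := by
      have h' : (q : ℝ) + 4 = 2 * p := by linarith
      have h'' : q + 4 = 2 * p := by exact_mod_cast h'
      omega
    have lt_00 : SLt (treeD p q 0 1) (treeB p q 0 0) :=
      sLt_treeD_treeB hP hQ d01 h00 (m := b + 2) (m' := a + 3) (by omega) (by omega) (by omega)
        (.inl (by simp only [hostFour]; nlinarith))
    have lt_01 : SLt (treeD p q 0 1) (treeB p q 0 1) :=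
      sLt_treeD_treeB hP hQ d01 h01 (m := b + 2) (m' := a + 2) (by omega) (by omega) (by omega)
        (.inl (by simp only [hostFour]; nlinarith))
    have lt_20 : SLt (treeD p q 0 1) (treeB p q 2 0) := by
      refine sLt_treeD_treeB hP hQ d01 h20 (m := b + 2) (m' := a + 1) (by omega) (by omega)
        (by omega) (.inr ⟨?_, ?_⟩)
      · simp only [hostFour, h2]
        ring
      -- The two values of `hostSix` differ by 6a(a + 1), so a > 0 is needed; it follows from a < b
      -- = 2a.
      · obtain ⟨c, rfl⟩ := Nat.exists_eq_add_of_lt (show 0 < a by omega)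
        simp only [hostSix, h2]
        ring_nf
        nlinarith
    have lt_02 : SLt (treeB p q 0 2) (treeD p q 0 1) :=
      sLt_treeB_treeD hP hQ h02 d01 (m := a + 1) (m' := b + 2) (by omega) (by omega) (by omega)
        (by simp only [hostFour, h2]; nlinarith)
    refine ⟨⟨isBipartitionTree_treeD d01, ?_⟩, fun V _ T ⟨hT, hne⟩ => sLe_and_sEq_iff ?_⟩
    · rintro G (rfl | rfl | rfl)
      exacts [lt_00.isEmpty_iso, lt_01.isEmpty_iso, lt_20.isEmpty_iso]
    · rcases classify_tree hp hpq hT with ⟨⟨e⟩⟩ | ⟨⟨e⟩⟩ | ⟨⟨e⟩⟩ | ⟨⟨e⟩⟩ | e | h | ⟨h, -⟩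
      · exact ((hne _ (by simp)).false e).elim
      · exact ((hne _ (by simp)).false e).elim
      · exact ((hne _ (by simp)).false e).elim
      · exact .inr (lt_02.congr_left e)
      · exact .inl e
      · exact .inr (h.trans lt_02)
      · exact .inr h
  · have h2 : 2 * a < b := by
      have h' : 2 * p < (q : ℝ) + 4 := by linarith
      have h'' : 2 * p < q + 4 := by exact_mod_cast h'
      omega
    have lt_00 : SLt (treeB p q 0 2) (treeB p q 0 0) :=
      sLt_treeB_treeB hP hQ h02 h00 (m := a + 1) (m' := a + 3) (by omega) (by omega) (by omega)
        (by simp only [hostFour]; nlinarith)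
    have lt_01 : SLt (treeB p q 0 2) (treeB p q 0 1) :=
      sLt_treeB_treeB hP hQ h02 h01 (m := a + 1) (m' := a + 2) (by omega) (by omega) (by omega)
        (by simp only [hostFour]; nlinarith)
    have lt_d : SLt (treeD p q 0 1) (treeB p q 0 2) := by
      refine sLt_treeD_treeB hP hQ d01 h02 (m := b + 2) (m' := a + 1) (by omega) (by omega)
        (by omega) ?_
      -- At b = 2a + 1, that is q = 2p - 3, the two trees tie in S_4, and the values of `hostSix`
      -- differ by 6(a + 1)(a + 2). For larger b, S_4 already decides.
      rcases eq_or_lt_of_le (show 2 * a + 1 ≤ b from h2) with h3 | h3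
      · right
        simp only [hostFour, hostSix, ← h3]
        constructor
        · ring
        · ring_nf
          nlinarith
      · left
        simp only [hostFour]
        nlinarith
    refine ⟨⟨isBipartitionTree_treeB h02, ?_⟩, fun V _ T ⟨hT, hne⟩ => sLe_and_sEq_iff ?_⟩
    · rintro G (rfl | rfl | rfl)
      exacts [lt_00.isEmpty_iso, lt_01.isEmpty_iso, lt_0220.isEmpty_iso]
    · rcases classify_tree hp hpq hT with ⟨⟨e⟩⟩ | ⟨⟨e⟩⟩ | ⟨⟨e⟩⟩ | e | ⟨⟨e⟩⟩ | h | ⟨h, -⟩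
      · exact ((hne _ (by simp)).false e).elim
      · exact ((hne _ (by simp)).false e).elim
      · exact ((hne _ (by simp)).false e).elim
      · exact .inl e
      · exact .inr (lt_d.congr_left e)
      · exact .inr h
      · exact .inr (h.trans lt_d)
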